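/- All vector spaces are over $\mathbb{C}$. A Lie conformal algebra is a $\mathbb{C}[\partial]$-module $\mathcal{A}$ with a $\mathbb{C}$-bilinear $\lambda$-bracket $\mathcal{A}\otimes\mathcal{A}\to\mathbb{C}[\lambda]\otimes\mathcal{A}$ satisfying $[\partial a_\lambda b]=-\lambda[a_\lambda b]$, $[a_\lambda\partial b]=(\partial+\lambda)[a_\lambda b]$, $[a_\lambda b]=-[b_{-\lambda-\partial}a]$ and $[a_\lambda[b_\mu c]]=[[a_\lambda b]_{\lambda+\mu}c]+[b_\mu[a_\lambda c]]$. Let $\widetilde{\mathcal{SV}}$ be the extended Schrödinger–Virasoro conformal algebra, i.e. the free $\mathbb{C}[\partial]$-module on $L,N,Y,M$ with nonzero $\lambda$-brackets of generators $[L_\lambda L]=(\partial+2\lambda)L$, $[L_\lambda Y]=(\partial+\tfrac32\lambda)Y$, $[Y_\lambda Y]=(\partial+2\lambda)M$, $[L_\lambda M]=(\partial+\lambda)M$, $[L_\lambda N]=(\partial+\lambda)N$, $[N_\lambda Y]=Y$, $[N_\lambda M]=2M$, together with those obtained from these by skew-symmetry. Let $\mathrm{Vir}=\mathbb{C}[\partial]L$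 with $[L_\lambda L]=(\partial+2\lambda)L$ be the Virasoro conformal algebra. Write $\langle X_1,\dots,X_n\rangle=\mathbb{C}[\partial]X_1+\cdots+\mathbb{C}[\partial]X_n$. For a Lie conformal algebra $\mathcal{A}$ and the trivial module $\mathbb{C}$ (on which $\partial$ and $\mathcal{A}_\lambda$ act by $0$), let $\tilde C^n(\mathcal{A},\mathbb{C})$ be the space of linear maps $\gamma:\mathcal{A}^{\otimes n}\to\mathbb{C}[\lambda_1,\dots,\lambda_n]$ with $\gamma_{\lambda_1,\dots,\lambda_n}(\dots,\partial a_i,\dots)=-\lambda_i\gamma_{\lambda_1,\dots,\lambda_n}(\dots,a_i,\dots)$ that are skew-symmetric under simultaneous permutations of the $a_i$ and the $\lambda_i$. The differential is $$(d\gamma)_{\lambda_1,\dots,\lambda_{n+1}}(a_1,\dots,a_{n+1})=\sum_{1\le i<j\le n+1}(-1)^{i+j}\gamma_{\lambda_i+\lambda_j,\lambda_1,\dots,\hat\lambda_i,\dots,\hat\lambda_j,\dots,\lambda_{n+1}}([a_{i\,\lambda_i}a_j],a_1,\dots,\hat a_i,\dots,\hat a_j,\dots,a_{n+1}),$$ where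 $\gamma$ is extended linearly over polynomials in the $\lambda_i$, and $\partial$ acts by $\partial\gamma=(\lambda_1+\cdots+\lambda_n)\gamma$. For a subalgebra $\mathcal{B}\subset\mathcal{A}$, the relative cochains $\tilde C^n(\mathcal{A};\mathcal{B},\mathbb{C})$ are the $\gamma\in\tilde C^n(\mathcal{A},\mathbb{C})$ with $\gamma(a_1,\dots,a_n)=0$ whenever $n\ge1$ and $a_1\in\mathcal{B}$, and $(d\gamma)(b_1,\dots,b_{n+1})=0$ whenever $b_1\in\mathcal{B}$. The cohomologies of the complexes $\tilde C^\bullet(\mathcal{A},\mathbb{C})$ and $\tilde C^\bullet(\mathcal{A};\mathcal{B},\mathbb{C})$ are the basic cohomology $\tilde H^q(\mathcal{A},\mathbb{C})$ and the basic relative cohomology $\tilde H^q(\mathcal{A};\mathcal{B},\mathbb{C})$; the cohomologies of the quotient complexes $\tilde C^\bullet/\partial\tilde C^\bullet$ are the reduced cohomology $H^q(\mathcal{A},\mathbb{C})$ and the reduced relative cohomology $H^q(\mathcal{A};\mathcal{B},\mathbb{C})$. The action of $\partial$ on cochains makes the basic (relative) cohomology a $\mathbb{C}[\partial]$-module. **Theorem.**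 If $\mathcal{B}=\langle N\rangle$, $\langle N,M\rangle$ or $\langle N,Y,M\rangle$, then for every integer $q\ge0$ $$\tilde H^q(\widetilde{\mathcal{SV}};\mathcal{B},\mathbb{C})\cong\tilde H^q(\mathrm{Vir},\mathbb{C})\quad\text{(as }\mathbb{C}[\partial]\text{-modules)},\qquad H^q(\widetilde{\mathcal{SV}};\mathcal{B},\mathbb{C})\cong H^q(\mathrm{Vir},\mathbb{C})\quad\text{(as vector spaces)}.$$ -/

import Mathlib

open Polynomial

noncomputable section

namespace LieConformal

/-! ### Lie conformal algebras

A `ℂ[∂]`-module is a complex vector space `A` with a linear endomorphism `der` (the action of `∂`).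
The space `A[λ] = ℂ[λ] ⊗ A` of polynomials in `λ` with coefficients in `A` is `ℕ →₀ A`:
the element `x` stands for `∑ n, λ ^ n • x n`. -/

/-- Substitution of a number `t` for `λ` in an element of `A[λ]`. -/
def evalAt {A : Type*} [AddCommGroup A] [Module ℂ A] (t : ℂ) (x : ℕ →₀ A) : A :=
  x.sum fun n c => t ^ n • c

/-- Substitution of an endomorphism `T` for `λ` in an element of `A[λ]`, that is `∑ n, T ^ n (x n)`. -/
def evalEnd {A : Type*} [AddCommGroup A] [Module ℂ A] (T : Module.End ℂ A) (x : ℕ →₀ A) : A :=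
  x.sum fun n c => (T ^ n) c

/-- The structure of a Lie conformal algebra on the vector space `A`: the action `der` of `∂` and
the `λ`-bracket `A ⊗ A → A[λ]`. Since `ℂ` is infinite, an identity between polynomials in `λ`
(or `λ, μ`) with coefficients in `A` holds iff it holds for all complex values of the variables;
the axioms are written in the latter form. -/
structure LieConformalAlgebra (A : Type*) [AddCommGroup A] [Module ℂ A] where
  der : Module.End ℂ A
  bracket : A →ₗ[ℂ] A →ₗ[ℂ] (ℕ →₀ A)
  /-- `[∂a_λ b] = -λ [a_λ b]` -/
  der_bracket : ∀ (a b : A) (t : ℂ), evalAt t (bracket (der a) b) = -t • evalAt t (bracket a b)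
  /-- `[a_λ ∂b] = (∂ + λ) [a_λ b]` -/
  bracket_der : ∀ (a b : A) (t : ℂ),
    evalAt t (bracket a (der b)) = der (evalAt t (bracket a b)) + t • evalAt t (bracket a b)
  /-- `[a_λ b] = - [b_{-λ-∂} a]` -/
  skew : ∀ (a b : A) (t : ℂ),
    evalAt t (bracket a b) = - evalEnd (-(t • (1 : Module.End ℂ A)) - der) (bracket b a)
  /-- `[a_λ [b_μ c]] = [[a_λ b]_{λ+μ} c] + [b_μ [a_λ c]]` -/
  jacobi : ∀ (a b c : A) (t u : ℂ),
    evalAt t (bracket a (evalAt u (bracket b c))) =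
      evalAt (t + u) (bracket (evalAt t (bracket a b)) c) +
        evalAt u (bracket b (evalAt t (bracket a c)))

/-- A subalgebra: a `ℂ[∂]`-submodule `B` with `[b_λ c] ∈ B[λ]` for all `b, c ∈ B`. -/
structure ConformalSubalgebra {A : Type*} [AddCommGroup A] [Module ℂ A]
    (𝒜 : LieConformalAlgebra A) where
  carrier : Submodule ℂ A
  der_mem : ∀ a ∈ carrier, 𝒜.der a ∈ carrier
  bracket_mem : ∀ a ∈ carrier, ∀ b ∈ carrier, ∀ n : ℕ, 𝒜.bracket a b n ∈ carrier

/-! ### Cochains with coefficients in the trivial module `ℂ`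

On the trivial module `ℂ` both `∂` and all `a_λ` act by zero. -/

/-- All functions `(a_1, …, a_n) ↦ γ_{λ_1, …, λ_n}(a_1, …, a_n)` from `A ^ n` to
`ℂ[λ_1, …, λ_n]`. Indices start from `0`, so `MvPolynomial.X i` is `λ_{i+1}`. -/
abbrev PreCochain (A : Type*) (n : ℕ) : Type _ := (Fin n → A) → MvPolynomial (Fin n) ℂ

section Complex

variable {A : Type*} [AddCommGroup A] [Module ℂ A]

/-- The `ℂ[∂]`-module structure: `∂γ = (λ_1 + ⋯ + λ_n) γ` (with `∂` acting by `0` on `ℂ`). -/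
def del (A : Type*) (n : ℕ) : PreCochain A n →ₗ[ℂ] PreCochain A n where
  toFun γ := fun a => (∑ i, MvPolynomial.X i) * γ a
  map_add' γ δ := by ext1 a; simp [mul_add]
  map_smul' r γ := by ext1 a; simp

/-- For `i < j`, the list `v` with its `i`-th and `j`-th entries omitted, and `x` put in front. -/
def consOmit {α : Type*} {m : ℕ} (x : α) (v : Fin (m + 2) → α) (i : Fin (m + 1))
    (j : Fin (m + 2)) : Fin (m + 1) → α :=
  Fin.cons x fun k : Fin m => v (j.succAbove (i.succAbove k))

/-- For `i < j`, the term
`γ_{λ_i+λ_j, λ_1, …, λ̂_i, …, λ̂_j, …}([a_i λ_i a_j], a_1, …, â_i, …, â_j, …)`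
of the differential, where `γ` is extended linearly over polynomials in `λ_i`. -/
def dTerm (𝒜 : LieConformalAlgebra A) {m : ℕ} (γ : PreCochain A (m + 1)) (a : Fin (m + 2) → A)
    (i : Fin (m + 1)) (j : Fin (m + 2)) : MvPolynomial (Fin (m + 2)) ℂ :=
  (𝒜.bracket (a i.castSucc) (a j)).sum fun k c =>
    MvPolynomial.X i.castSucc ^ k *
      MvPolynomial.aeval
        (consOmit (MvPolynomial.X i.castSucc + MvPolynomial.X j) MvPolynomial.X i j)
        (γ (consOmit c a i j))

/-- The differential, for the trivial module `ℂ`: the sum over `i < j` of `(-1) ^ (i + j)` times the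
terms above. (It is zero on `0`-cochains, as `A` acts by zero on `ℂ`.) -/
def d (𝒜 : LieConformalAlgebra A) : (n : ℕ) → PreCochain A n →ₗ[ℂ] PreCochain A (n + 1)
  | 0 => 0
  | m + 1 =>
    { toFun := fun γ a => ∑ j : Fin (m + 2), ∑ i : Fin (m + 1),
        if i.castSucc < j then (-1 : ℂ) ^ ((i : ℕ) + (j : ℕ)) • dTerm 𝒜 γ a i j else 0
      map_add' := by
        intro γ δ
        ext1 a
        simp only [Pi.add_apply, ← Finset.sum_add_distrib]
        refine Finset.sum_congr rfl fun j _ => Finset.sum_congr rfl fun i _ => ?_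
        split_ifs
        · simp [dTerm, mul_add, Finsupp.sum_add, smul_add]
        · simp
      map_smul' := by
        intro r γ
        ext1 a
        simp only [Pi.smul_apply, RingHom.id_apply, Finset.smul_sum]
        refine Finset.sum_congr rfl fun j _ => Finset.sum_congr rfl fun i _ => ?_
        split_ifs
        · rw [smul_comm]
          simp [dTerm, Finsupp.smul_sum]
        · simp }

/-- `n`-cochains of `𝒜` with coefficients in `ℂ`: multilinear maps
`(a_1, …, a_n) ↦ γ_{λ_1, …, λ_n}(a_1, …, a_n)` that are conformally antilinear, and skew-symmetric
with respect to simultaneous permutations of the `a_i` and the `λ_i`. -/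
def cochains (𝒜 : LieConformalAlgebra A) (n : ℕ) : Submodule ℂ (PreCochain A n) where
  carrier := {γ |
    (∃ f : MultilinearMap ℂ (fun _ : Fin n => A) (MvPolynomial (Fin n) ℂ), ⇑f = γ) ∧
    (∀ (a : Fin n → A) (i : Fin n),
      γ (Function.update a i (𝒜.der (a i))) = - (MvPolynomial.X i * γ a)) ∧
    (∀ (a : Fin n → A) (σ : Equiv.Perm (Fin n)),
      MvPolynomial.rename σ (γ (a ∘ σ)) = (Equiv.Perm.sign σ : ℤ) • γ a)}
  zero_mem' := ⟨⟨0, rfl⟩, by simp, by simp⟩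
  add_mem' := by
    rintro _ _ ⟨⟨f, rfl⟩, h1, h2⟩ ⟨⟨g, rfl⟩, h3, h4⟩
    refine ⟨⟨f + g, rfl⟩, fun a i => ?_, fun a σ => ?_⟩
    · simp only [Pi.add_apply, h1, h3]; ring
    · simp only [Pi.add_apply, map_add, h2, h4, smul_add]
  smul_mem' := by
    rintro r _ ⟨⟨f, rfl⟩, h1, h2⟩
    refine ⟨⟨r • f, rfl⟩, fun a i => ?_, fun a σ => ?_⟩
    · simp only [Pi.smul_apply, h1, smul_neg, mul_smul_comm]
    · simp only [Pi.smul_apply, map_smul, h2, smul_comm r]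

/-- Relative `n`-cochains of `𝒜` modulo the subalgebra `ℬ`: the `n`-cochains `γ` such that
`γ(a_1, …, a_n) = 0` and `(dγ)(b_1, …, b_{n+1}) = 0` whenever `a_1 ∈ ℬ` and `b_1 ∈ ℬ`.
(For `n = 0` there is no `a_1`, and the first condition is empty.) -/
def relCochains (𝒜 : LieConformalAlgebra A) (ℬ : ConformalSubalgebra 𝒜) (n : ℕ) :
    Submodule ℂ (PreCochain A n) where
  carrier := {γ | γ ∈ cochains 𝒜 n ∧
    (∀ (a : Fin n → A) (hn : 0 < n), a ⟨0, hn⟩ ∈ ℬ.carrier → γ a = 0) ∧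
    (∀ b : Fin (n + 1) → A, b 0 ∈ ℬ.carrier → d 𝒜 n γ b = 0)}
  zero_mem' := ⟨zero_mem _, by simp, by simp⟩
  add_mem' := by
    rintro γ δ ⟨h0, h1, h2⟩ ⟨k0, k1, k2⟩
    refine ⟨add_mem h0 k0, fun a hn ha => ?_, fun b hb => ?_⟩
    · simp [h1 a hn ha, k1 a hn ha]
    · simp [h2 b hb, k2 b hb]
  smul_mem' := by
    rintro r γ ⟨h0, h1, h2⟩
    refine ⟨Submodule.smul_mem _ r h0, fun a hn ha => ?_, fun b hb => ?_⟩
    · simp [h1 a hn ha]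
    · simp [h2 b hb]

theorem del_mem_cochains (𝒜 : LieConformalAlgebra A) (n : ℕ) (γ : PreCochain A n)
    (hγ : γ ∈ cochains 𝒜 n) : del A n γ ∈ cochains 𝒜 n := by
  obtain ⟨⟨f, rfl⟩, h1, h2⟩ := hγ
  refine ⟨⟨(LinearMap.mulLeft ℂ (∑ i, MvPolynomial.X i)).compMultilinearMap f, rfl⟩,
    fun a i => ?_, fun a σ => ?_⟩
  · simp only [del, LinearMap.coe_mk, AddHom.coe_mk, h1]; ring
  · simp only [del, LinearMap.coe_mk, AddHom.coe_mk, map_mul, h2, map_sum,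
      MvPolynomial.rename_X, mul_smul_comm]
    rw [Equiv.sum_comp σ (fun i => (MvPolynomial.X i : MvPolynomial (Fin n) ℂ))]

theorem d_del (𝒜 : LieConformalAlgebra A) (n : ℕ) (γ : PreCochain A n) :
    d 𝒜 n (del A n γ) = del A (n + 1) (d 𝒜 n γ) := by
  cases n with
  | zero => simp [d]
  | succ m =>
    ext1 a
    simp only [d, del, LinearMap.coe_mk, AddHom.coe_mk]
    rw [Finset.mul_sum]
    refine Finset.sum_congr rfl fun j _ => ?_
    rw [Finset.mul_sum]
    refine Finset.sum_congr rfl fun i _ => ?_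
    split_ifs with hij
    · have hsum : MvPolynomial.aeval
          (consOmit (MvPolynomial.X i.castSucc + MvPolynomial.X j) MvPolynomial.X i j)
          (∑ k : Fin (m + 1), (MvPolynomial.X k : MvPolynomial (Fin (m + 1)) ℂ)) =
          ∑ k : Fin (m + 2), (MvPolynomial.X k : MvPolynomial (Fin (m + 2)) ℂ) := by
        rw [map_sum]
        simp only [MvPolynomial.aeval_X]
        rw [Fin.sum_univ_succ, Fin.sum_univ_succAbove _ j,
          Fin.sum_univ_succAbove (fun k => MvPolynomial.X (j.succAbove k)) i,
          Fin.succAbove_of_castSucc_lt _ _ hij]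
        simp only [consOmit, Fin.cons_zero, Fin.cons_succ]
        ring
      rw [mul_smul_comm]
      congr 1
      simp only [dTerm, map_mul, hsum, Finsupp.sum, Finset.mul_sum]
      exact Finset.sum_congr rfl fun k _ => by ring
    · simp

theorem del_mem_relCochains (𝒜 : LieConformalAlgebra A) (ℬ : ConformalSubalgebra 𝒜) (n : ℕ)
    (γ : PreCochain A n) (hγ : γ ∈ relCochains 𝒜 ℬ n) : del A n γ ∈ relCochains 𝒜 ℬ n := by
  obtain ⟨h0, h1, h2⟩ := hγ
  refine ⟨del_mem_cochains 𝒜 n γ h0, fun a hn ha => ?_, fun b hb => ?_⟩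
  · simp [del, h1 a hn ha]
  · rw [d_del]; simp [del, h2 b hb]

/-- A graded subspace of the cochains that is stable under `∂`. -/
structure CochainSpaces (𝒜 : LieConformalAlgebra A) where
  space : (n : ℕ) → Submodule ℂ (PreCochain A n)
  del_mem : ∀ (n : ℕ) (γ : PreCochain A n), γ ∈ space n → del A n γ ∈ space n

/-- The basic complex of `𝒜` with coefficients in `ℂ`. -/
def basicComplex (𝒜 : LieConformalAlgebra A) : CochainSpaces 𝒜 :=
  ⟨cochains 𝒜, del_mem_cochains 𝒜⟩

/-- The complex of relative cochains of `𝒜` modulo `ℬ` with coefficients in `ℂ`. -/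
def relComplex (𝒜 : LieConformalAlgebra A) (ℬ : ConformalSubalgebra 𝒜) : CochainSpaces 𝒜 :=
  ⟨relCochains 𝒜 ℬ, del_mem_relCochains 𝒜 ℬ⟩

/-! ### Cohomology and reduced cohomology -/

variable {𝒜 : LieConformalAlgebra A} (K : CochainSpaces 𝒜)

/-- `q`-cocycles of `K`. -/
def cocycles (q : ℕ) : Submodule ℂ (PreCochain A q) :=
  K.space q ⊓ LinearMap.ker (d 𝒜 q)

/-- `q`-coboundaries of `K`: the images `d φ` of elements `φ` of degree `q - 1`. -/
def coboundaries : (q : ℕ) → Submodule ℂ (PreCochain A q)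
  | 0 => ⊥
  | q + 1 => (K.space q).map (d 𝒜 q)

/-- The cohomology in degree `q`: cocycles modulo coboundaries. -/
abbrev Cohomology (q : ℕ) : Type _ :=
  cocycles K q ⧸ (coboundaries K q).comap (cocycles K q).subtype

/-- The subspace `∂ K^q`. -/
def delSpace (q : ℕ) : Submodule ℂ (PreCochain A q) :=
  (K.space q).map (del A q)

/-- Representatives in `K^q` of the cocycles of the quotient complex `K / ∂K`. -/
def reducedCocycles (q : ℕ) : Submodule ℂ (PreCochain A q) :=
  K.space q ⊓ (delSpace K (q + 1)).comap (d 𝒜 q)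

/-- Representatives in `K^q` of the coboundaries of the quotient complex `K / ∂K`. -/
def reducedCoboundaries (q : ℕ) : Submodule ℂ (PreCochain A q) :=
  coboundaries K q ⊔ delSpace K q

/-- The reduced cohomology in degree `q`, that is, the cohomology of the quotient complex
`K / ∂K`. -/
abbrev ReducedCohomology (q : ℕ) : Type _ :=
  reducedCocycles K q ⧸ (reducedCoboundaries K q).comap (reducedCocycles K q).subtype

theorem del_mem_cocycles (q : ℕ) (γ : PreCochain A q) (h : γ ∈ cocycles K q) :
    del A q γ ∈ cocycles K q := by
  refine ⟨K.del_mem q γ h.1, ?_⟩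
  have h2 : d 𝒜 q γ = 0 := h.2
  simp [d_del, h2]

theorem del_mem_coboundaries (q : ℕ) (γ : PreCochain A q) (h : γ ∈ coboundaries K q) :
    del A q γ ∈ coboundaries K q := by
  cases q with
  | zero =>
    have h2 : γ = 0 := h
    simp [h2]
  | succ q =>
    obtain ⟨φ, hφ, rfl⟩ := h
    exact ⟨del A q φ, K.del_mem q φ hφ, d_del 𝒜 q φ⟩

/-- The action of `∂` on the cohomology. -/
def cohomologyDel (q : ℕ) : Module.End ℂ (Cohomology K q) :=
  Submodule.mapQ _ _ ((del A q).restrict (del_mem_cocycles K q))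
    (fun γ h => del_mem_coboundaries K q γ.1 h)

end Complex

/-! ### Free `ℂ[∂]`-modules with a `λ`-bracket given on generators

The free `ℂ[∂]`-module on a finite set `ι` of generators is `ι → ℂ[X]` (with `X = ∂`). The
polynomials in two variables `∂, λ` are `ℂ[X][X]`, with `C X = ∂` and `X = λ`. -/

section Free

variable {ι : Type*} [Fintype ι]

/-- A vector of polynomials in `∂, λ`, seen as a polynomial in `λ` with coefficients in `ℂ[∂]^ι`. -/
def bracketCoeffs (Q : ι → ℂ[X][X]) : ℕ →₀ (ι → ℂ[X]) :=
  Finsupp.onFinset (Finset.univ.biUnion fun k => (Q k).support) (fun n k => (Q k).coeff n) (by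
    intro n h
    by_contra hn
    exact h (funext fun k => by
      by_contra hk
      exact hn (Finset.mem_biUnion.2 ⟨k, Finset.mem_univ _, Polynomial.mem_support_iff.2 hk⟩)))

/-- The components of the sesquilinear extension of `[X_i λ X_j] = ∑ k, P i j k (∂, λ) X_k`:
`[f(∂) X_i λ g(∂) X_j] = ∑ k, f(-λ) g(∂+λ) P i j k (∂, λ) X_k`. -/
def freePoly (P : ι → ι → ι → ℂ[X][X]) (a b : ι → ℂ[X]) (k : ι) : ℂ[X][X] :=
  ∑ i, ∑ j, aeval (-X : ℂ[X][X]) (a i) * aeval (C X + X : ℂ[X][X]) (b j) * P i j k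

theorem bracketCoeffs_add (Q R : ι → ℂ[X][X]) : bracketCoeffs (Q + R) = bracketCoeffs Q + bracketCoeffs R := by
  ext n k : 2
  simp [bracketCoeffs]

theorem bracketCoeffs_smul (r : ℂ) (Q : ι → ℂ[X][X]) : bracketCoeffs (r • Q) = r • bracketCoeffs Q := by
  ext n k : 2
  simp only [bracketCoeffs, Finsupp.onFinset_apply, Pi.smul_apply, Polynomial.coeff_smul,
    Finsupp.smul_apply]

/-- The `λ`-bracket on the free `ℂ[∂]`-module with `[X_i λ X_j] = ∑ k, P i j k (∂, λ) X_k`. -/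
def freeBracket (P : ι → ι → ι → ℂ[X][X]) :
    (ι → ℂ[X]) →ₗ[ℂ] (ι → ℂ[X]) →ₗ[ℂ] (ℕ →₀ (ι → ℂ[X])) :=
  LinearMap.mk₂ ℂ (fun a b => bracketCoeffs (freePoly P a b))
    (fun a a' b => by
      rw [← bracketCoeffs_add]
      congr 1
      ext1 k
      simp only [freePoly, Pi.add_apply, map_add, add_mul, Finset.sum_add_distrib])
    (fun r a b => by
      rw [← bracketCoeffs_smul]
      congr 1
      ext1 k
      simp only [freePoly, Pi.smul_apply, map_smul, Finset.smul_sum, smul_mul_assoc])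
    (fun a b b' => by
      rw [← bracketCoeffs_add]
      congr 1
      ext1 k
      simp only [freePoly, Pi.add_apply, map_add, mul_add, add_mul, Finset.sum_add_distrib])
    (fun r a b => by
      rw [← bracketCoeffs_smul]
      congr 1
      ext1 k
      simp only [freePoly, Pi.smul_apply, map_smul, Finset.smul_sum, smul_mul_assoc,
        mul_smul_comm])

/-- Multiplication by `∂`. -/
def freeDer (ι : Type*) : Module.End ℂ (ι → ℂ[X]) where
  toFun a := fun k => X * a k
  map_add' a b := by ext1 k; simp [mul_add]
  map_smul' r a := by ext1 k; simp

theorem evalEnd_bracketCoeffs (T : Module.End ℂ (ι → ℂ[X])) (t : ℂ[X])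
    (hT : ∀ v k, T v k = t * v k) (Q : ι → ℂ[X][X]) (k : ι) :
    evalEnd T (bracketCoeffs Q) k = (Q k).eval t := by
  have hpow : ∀ (n : ℕ) (v : ι → ℂ[X]), (T ^ n) v k = t ^ n * v k := by
    intro n
    induction n with
    | zero => intro v; simp
    | succ n ih => intro v; rw [pow_succ, Module.End.mul_apply, ih, hT]; ring
  have h1 : evalEnd T (bracketCoeffs Q) =
      ∑ n ∈ Finset.univ.biUnion fun k => (Q k).support, (T ^ n) (fun k => (Q k).coeff n) := by
    unfold evalEnd
    exact Finsupp.sum_of_support_subset _ Finsupp.support_onFinset_subset _ (by simp)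
  rw [h1, Finset.sum_apply, Polynomial.eval_eq_sum, Polynomial.sum]
  simp only [hpow]
  rw [Finset.sum_subset (s₁ := (Q k).support) (s₂ := Finset.univ.biUnion fun k => (Q k).support)
    (fun n hn => Finset.mem_biUnion.2 ⟨k, Finset.mem_univ _, hn⟩)]
  · exact Finset.sum_congr rfl fun n _ => mul_comm _ _
  · intro n _ hn
    simp [Polynomial.notMem_support_iff.1 hn]

theorem evalAt_eq (t : ℂ) {A : Type*} [AddCommGroup A] [Module ℂ A] (x : ℕ →₀ A) :
    evalAt t x = evalEnd (t • (1 : Module.End ℂ A)) x := by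
  simp [evalAt, evalEnd, _root_.smul_pow]

theorem evalAt_bracketCoeffs (t : ℂ) (Q : ι → ℂ[X][X]) (k : ι) :
    evalAt t (bracketCoeffs Q) k = (Q k).eval (C t) := by
  rw [evalAt_eq, evalEnd_bracketCoeffs]
  intro v k
  simp [Polynomial.smul_eq_C_mul]

theorem eval_aeval (r s : ℂ[X]) (p : ℂ[X][X]) (f : ℂ[X]) (h : p.eval s = r) :
    (aeval p f).eval s = f.comp r := by
  induction f using Polynomial.induction_on' with
  | add f g hf hg => simp [hf, hg]
  | monomial n c =>
    simp [aeval_monomial, h, IsScalarTower.algebraMap_apply ℂ ℂ[X] ℂ[X][X]]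

theorem eval_freePoly (P : ι → ι → ι → ℂ[X][X]) (a b : ι → ℂ[X]) (k : ι) (s : ℂ[X]) :
    (freePoly P a b k).eval s =
      ∑ i, ∑ j, (a i).comp (-s) * (b j).comp (X + s) * (P i j k).eval s := by
  simp only [freePoly, eval_finsetSum, eval_mul]
  refine Finset.sum_congr rfl fun i _ => Finset.sum_congr rfl fun j _ => ?_
  rw [eval_aeval (-s) s _ _ (by simp), eval_aeval (X + s) s _ _ (by simp)]

theorem evalAt_freeBracket (P : ι → ι → ι → ℂ[X][X]) (a b : ι → ℂ[X]) (t : ℂ) (k : ι) :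
    evalAt t (freeBracket P a b) k =
      ∑ i, ∑ j, (a i).comp (-C t) * (b j).comp (X + C t) * (P i j k).eval (C t) := by
  rw [← eval_freePoly, ← evalAt_bracketCoeffs]
  rfl

theorem comp_neg_C (f : ℂ[X]) (t : ℂ) : f.comp (-C t) = C (f.eval (-t)) := by
  rw [← C_neg, comp_C]

/-- The Lie conformal algebra, free as a `ℂ[∂]`-module, with
`[X_i λ X_j] = ∑ k, P i j k (∂, λ) X_k`; skew-symmetry and the Jacobi identity have to be
verified on the generators only. -/
def freeLie (P : ι → ι → ι → ℂ[X][X])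
    (hskew : ∀ (i j k : ι) (t : ℂ), (P i j k).eval (C t) = - (P j i k).eval (-C t - X))
    (hjac : ∀ (i j k m : ι) (t u : ℂ),
      ∑ l, ((P j k l).eval (C u)).comp (X + C t) * (P i l m).eval (C t) =
        ∑ l, ((P i j l).eval (C t)).comp (-C (t + u)) * (P l k m).eval (C (t + u)) +
          ∑ l, ((P i k l).eval (C t)).comp (X + C u) * (P j l m).eval (C u)) :
    LieConformalAlgebra (ι → ℂ[X]) where
  der := freeDer ι
  bracket := freeBracket P
  der_bracket a b t := by
    ext1 k
    simp only [evalAt_freeBracket, freeDer, LinearMap.coe_mk, AddHom.coe_mk, Pi.smul_apply,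
      Finset.smul_sum, mul_comp, X_comp, Polynomial.smul_eq_C_mul, C_neg]
    refine Finset.sum_congr rfl fun i _ => Finset.sum_congr rfl fun j _ => ?_
    ring
  bracket_der a b t := by
    ext1 k
    simp only [evalAt_freeBracket, freeDer, LinearMap.coe_mk, AddHom.coe_mk, Pi.smul_apply,
      Pi.add_apply, Finset.smul_sum, Finset.mul_sum, mul_comp, X_comp, Polynomial.smul_eq_C_mul,
      ← Finset.sum_add_distrib]
    refine Finset.sum_congr rfl fun i _ => Finset.sum_congr rfl fun j _ => ?_
    ring
  skew a b t := by
    ext1 k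
    have hT : ∀ (v : ι → ℂ[X]) (k : ι),
        (-(t • (1 : Module.End ℂ (ι → ℂ[X]))) - freeDer ι) v k = (-C t - X) * v k := by
      intro v k
      simp [freeDer, Polynomial.smul_eq_C_mul, sub_mul]
    rw [evalAt_freeBracket, Pi.neg_apply]
    change _ = - evalEnd _ (bracketCoeffs (freePoly P b a)) k
    rw [evalEnd_bracketCoeffs _ _ hT, eval_freePoly, Finset.sum_comm, ← Finset.sum_neg_distrib]
    refine Finset.sum_congr rfl fun j _ => ?_
    rw [← Finset.sum_neg_distrib]
    refine Finset.sum_congr rfl fun i _ => ?_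
    rw [hskew, show -(-C t - X : ℂ[X]) = X + C t by ring,
      show (X + (-C t - X) : ℂ[X]) = -C t by ring]
    ring
  jacobi a b c t u := by
    ext1 m
    have key : ∀ i j k, (a i).comp (-C t) * (b j).comp (-C u) * (c k).comp (X + C (t + u)) *
        (∑ l, ((P j k l).eval (C u)).comp (X + C t) * (P i l m).eval (C t)) =
        (a i).comp (-C t) * (b j).comp (-C u) * (c k).comp (X + C (t + u)) *
          (∑ l, ((P i j l).eval (C t)).comp (-C (t + u)) * (P l k m).eval (C (t + u))) +
        (a i).comp (-C t) * (b j).comp (-C u) * (c k).comp (X + C (t + u)) *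
          (∑ l, ((P i k l).eval (C t)).comp (X + C u) * (P j l m).eval (C u)) := by
      intro i j k
      rw [hjac, mul_add]
    have hx : ∀ (f : ℂ[X]) (v w : ℂ), (f.comp (X + C v)).comp (X + C w) =
        f.comp (X + C (v + w)) := by
      intro f v w
      simp only [comp_assoc, add_comp, X_comp, C_comp, C_add]
      congr 1; ring
    have e1 : evalAt t (freeBracket P a (evalAt u (freeBracket P b c))) m =
        ∑ i, ∑ j, ∑ k, (a i).comp (-C t) * (b j).comp (-C u) * (c k).comp (X + C (t + u)) *
        (∑ l, ((P j k l).eval (C u)).comp (X + C t) * (P i l m).eval (C t)) := by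
      rw [evalAt_freeBracket]
      refine Finset.sum_congr rfl fun i _ => ?_
      simp only [evalAt_freeBracket, sum_comp, mul_comp, hx, Finset.mul_sum, Finset.sum_mul]
      rw [Finset.sum_comm]
      refine Finset.sum_congr rfl fun j _ => ?_
      rw [Finset.sum_comm]
      refine Finset.sum_congr rfl fun k _ => Finset.sum_congr rfl fun l _ => ?_
      rw [comp_neg_C (b j), C_comp, add_comm u t]
      ring
    have e2 : evalAt u (freeBracket P b (evalAt t (freeBracket P a c))) m =
        ∑ i, ∑ j, ∑ k, (a i).comp (-C t) * (b j).comp (-C u) * (c k).comp (X + C (t + u)) *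
        (∑ l, ((P i k l).eval (C t)).comp (X + C u) * (P j l m).eval (C u)) := by
      rw [evalAt_freeBracket, Finset.sum_comm (s := Finset.univ (α := ι)) (t := Finset.univ (α := ι))
        (f := fun i j => ∑ k, (a i).comp (-C t) * (b j).comp (-C u) * (c k).comp (X + C (t + u)) *
        (∑ l, ((P i k l).eval (C t)).comp (X + C u) * (P j l m).eval (C u)))]
      refine Finset.sum_congr rfl fun j _ => ?_
      simp only [evalAt_freeBracket, sum_comp, mul_comp, hx, Finset.mul_sum, Finset.sum_mul]
      rw [Finset.sum_comm]
      refine Finset.sum_congr rfl fun i _ => ?_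
      rw [Finset.sum_comm]
      refine Finset.sum_congr rfl fun k _ => Finset.sum_congr rfl fun l _ => ?_
      rw [comp_neg_C (a i), C_comp]
      ring
    have e3 : evalAt (t + u) (freeBracket P (evalAt t (freeBracket P a b)) c) m =
        ∑ i, ∑ j, ∑ k, (a i).comp (-C t) * (b j).comp (-C u) * (c k).comp (X + C (t + u)) *
        (∑ l, ((P i j l).eval (C t)).comp (-C (t + u)) * (P l k m).eval (C (t + u))) := by
      have hb : ∀ j, ((b j).comp (X + C t)).comp (-C (t + u)) = (b j).comp (-C u) := by
        intro j
        simp only [comp_assoc, add_comp, X_comp, C_comp, C_add]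
        congr 1; ring
      rw [evalAt_freeBracket]
      simp only [evalAt_freeBracket, sum_comp, mul_comp, hb, Finset.mul_sum, Finset.sum_mul]
      rw [Finset.sum_congr rfl fun l _ => Finset.sum_comm, Finset.sum_comm]
      refine Finset.sum_congr rfl fun i _ => ?_
      rw [Finset.sum_congr rfl fun l _ => Finset.sum_comm, Finset.sum_comm]
      refine Finset.sum_congr rfl fun j _ => ?_
      rw [Finset.sum_comm]
      refine Finset.sum_congr rfl fun k _ => Finset.sum_congr rfl fun l _ => ?_
      rw [comp_neg_C (a i), C_comp]
      ring
    rw [Pi.add_apply, e1, e2, e3]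
    simp only [← Finset.sum_add_distrib, key]

end Free

/-! ### The Virasoro and the extended Schrödinger–Virasoro conformal algebras -/

/-- The generators of the extended Schrödinger–Virasoro conformal algebra. -/
inductive SVGen
  | L | N | Y | M
  deriving DecidableEq

instance : Fintype SVGen where
  elems := {.L, .N, .Y, .M}
  complete i := by cases i <;> simp

/-- The brackets of the generators: `svTable i j k` is the coefficient in `ℂ[∂][λ]` of the generator
`k` in `[i_λ j]`. -/
def svTable : SVGen → SVGen → SVGen → ℂ[X][X]
  -- `[L_λ L] = (∂ + 2λ) L`
  | .L, .L, .L => C X + 2 * X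
  -- `[L_λ Y] = (∂ + (3/2) λ) Y`, `[Y_λ L] = ((1/2) ∂ + (3/2) λ) Y`
  | .L, .Y, .Y => C X + C (C (3 / 2)) * X
  | .Y, .L, .Y => C (C (1 / 2)) * C X + C (C (3 / 2)) * X
  -- `[Y_λ Y] = (∂ + 2λ) M`
  | .Y, .Y, .M => C X + 2 * X
  -- `[L_λ M] = (∂ + λ) M`, `[M_λ L] = λ M`
  | .L, .M, .M => C X + X
  | .M, .L, .M => X
  -- `[L_λ N] = (∂ + λ) N`, `[N_λ L] = λ N`
  | .L, .N, .N => C X + X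
  | .N, .L, .N => X
  -- `[N_λ Y] = Y`, `[Y_λ N] = -Y`
  | .N, .Y, .Y => 1
  | .Y, .N, .Y => -1
  -- `[N_λ M] = 2 M`, `[M_λ N] = -2 M`
  | .N, .M, .M => 2
  | .M, .N, .M => -2
  | _, _, _ => 0

theorem sum_svGen {M : Type*} [AddCommMonoid M] (f : SVGen → M) :
    ∑ i, f i = f .L + f .N + f .Y + f .M := by
  rw [show (Finset.univ : Finset SVGen) = {.L, .N, .Y, .M} from rfl]
  simp [add_assoc]

theorem svTable_skew (i j k : SVGen) (t : ℂ) :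
    (svTable i j k).eval (C t) = - (svTable j i k).eval (-C t - X) := by
  have h3 : (C (3 / 2 : ℂ) : ℂ[X]) = 3 * C (1 / 2) := by
    rw [show (3 / 2 : ℂ) = 3 * (1 / 2) by norm_num, C_mul]; rfl
  have h2 : 2 * (C (1 / 2) : ℂ[X]) = 1 := by
    rw [show (2 : ℂ[X]) = C 2 from rfl, ← C_mul]; norm_num
  rcases i with (_ | _ | _ | _) <;> rcases j with (_ | _ | _ | _) <;>
    rcases k with (_ | _ | _ | _) <;>
    simp only [svTable, eval_zero, neg_zero, neg_neg, eval_add, eval_mul, eval_C, eval_X, eval_one,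
      eval_neg, eval_ofNat, h3]
  all_goals generalize (C (1 / 2) : ℂ[X]) = h at h2 ⊢
  all_goals first | ring1 | grind

theorem svTable_jacobi (i j k m : SVGen) (t u : ℂ) :
    ∑ l, ((svTable j k l).eval (C u)).comp (X + C t) * (svTable i l m).eval (C t) =
      ∑ l, ((svTable i j l).eval (C t)).comp (-C (t + u)) * (svTable l k m).eval (C (t + u)) +
        ∑ l, ((svTable i k l).eval (C t)).comp (X + C u) * (svTable j l m).eval (C u) := by
  have h3 : (C (3 / 2 : ℂ) : ℂ[X]) = 3 * C (1 / 2) := by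
    rw [show (3 / 2 : ℂ) = 3 * (1 / 2) by norm_num, C_mul]; rfl
  have h2 : 2 * (C (1 / 2) : ℂ[X]) = 1 := by
    rw [show (2 : ℂ[X]) = C 2 from rfl, ← C_mul]; norm_num
  simp only [sum_svGen]
  rcases i with (_ | _ | _ | _) <;> rcases j with (_ | _ | _ | _) <;>
    rcases k with (_ | _ | _ | _) <;> rcases m with (_ | _ | _ | _) <;>
    simp only [svTable, eval_zero, zero_comp, zero_mul, mul_zero, add_zero, zero_add] <;>
    simp only [eval_add, eval_mul, eval_C, eval_X, eval_one, eval_neg, eval_ofNat,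
      add_comp, mul_comp, X_comp, C_comp, one_comp, neg_comp, ofNat_comp, C_add, h3]
  all_goals generalize (C (1 / 2) : ℂ[X]) = h at h2 ⊢
  all_goals first | ring1 | grind

/-- The extended Schrödinger–Virasoro conformal algebra `ℂ[∂]L ⊕ ℂ[∂]N ⊕ ℂ[∂]Y ⊕ ℂ[∂]M`. -/
def SV : LieConformalAlgebra (SVGen → ℂ[X]) :=
  freeLie svTable svTable_skew svTable_jacobi

/-- `⟨X_1, …, X_n⟩ = ℂ[∂] X_1 + ⋯ + ℂ[∂] X_n`, for a set of generators `X_1, …, X_n`. -/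
def genSpan (S : Set SVGen) : Submodule ℂ (SVGen → ℂ[X]) :=
  (Submodule.span ℂ[X] ((fun i => Pi.single i (1 : ℂ[X])) '' S)).restrictScalars ℂ

theorem mem_genSpan (S : Set SVGen) (a : SVGen → ℂ[X]) :
    a ∈ genSpan S ↔ ∀ i, i ∉ S → a i = 0 := by
  constructor
  · intro h
    have h' : a ∈ Submodule.span ℂ[X] ((fun i => Pi.single i (1 : ℂ[X])) '' S) := h
    intro i hi
    induction h' using Submodule.span_induction with
    | mem x hx =>
      obtain ⟨j, hj, rfl⟩ := hx
      exact Pi.single_eq_of_ne (fun (h : i = j) => hi (by rw [h]; exact hj)) _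
    | zero => rfl
    | add x y hx hy h1 h2 => rw [Pi.add_apply, h1 hx, h2 hy, add_zero]
    | smul r x hx h1 => rw [Pi.smul_apply, h1 hx, smul_zero]
  · intro h
    change a ∈ Submodule.span ℂ[X] ((fun i => Pi.single i (1 : ℂ[X])) '' S)
    have ha : a = ∑ i, a i • (Pi.single i (1 : ℂ[X]) : SVGen → ℂ[X]) := by
      ext1 k
      simp [Finset.sum_apply, Pi.single_apply]
    rw [ha]
    refine Submodule.sum_mem _ fun i _ => ?_
    by_cases hi : i ∈ S
    · exact Submodule.smul_mem _ _ (Submodule.subset_span ⟨i, hi, rfl⟩)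
    · rw [h i hi, zero_smul]
      exact Submodule.zero_mem _

/-- The subalgebra `⟨X_1, …, X_n⟩` of the extended Schrödinger–Virasoro conformal algebra, for a set
of generators that is closed under the bracket. -/
def svSubalgebra (S : Set SVGen)
    (hS : ∀ i ∈ S, ∀ j ∈ S, ∀ k, k ∉ S → svTable i j k = 0) : ConformalSubalgebra SV where
  carrier := genSpan S
  der_mem a ha := by
    rw [mem_genSpan] at ha ⊢
    intro i hi
    change X * a i = 0
    rw [ha i hi, mul_zero]
  bracket_mem a ha b hb n := by
    rw [mem_genSpan] at ha hb ⊢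
    intro k hk
    change (freePoly svTable a b k).coeff n = 0
    have h0 : freePoly svTable a b k = 0 := by
      refine Finset.sum_eq_zero fun i _ => Finset.sum_eq_zero fun j _ => ?_
      by_cases hi : i ∈ S
      · by_cases hj : j ∈ S
        · rw [hS i hi j hj k hk, mul_zero]
        · rw [hb j hj, map_zero, mul_zero, zero_mul]
      · rw [ha i hi, map_zero, zero_mul, zero_mul]
    rw [h0, coeff_zero]

/-- The subalgebra `⟨N⟩`. -/
def subN : ConformalSubalgebra SV :=
  svSubalgebra {.N} (by
    rintro (_ | _ | _ | _) hi (_ | _ | _ | _) hj (_ | _ | _ | _) hk <;> simp_all [svTable])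

/-- The subalgebra `⟨N, M⟩`. -/
def subNM : ConformalSubalgebra SV :=
  svSubalgebra {.N, .M} (by
    rintro (_ | _ | _ | _) hi (_ | _ | _ | _) hj (_ | _ | _ | _) hk <;> simp_all [svTable])

/-- The subalgebra `⟨N, Y, M⟩`. -/
def subNYM : ConformalSubalgebra SV :=
  svSubalgebra {.N, .Y, .M} (by
    rintro (_ | _ | _ | _) hi (_ | _ | _ | _) hj (_ | _ | _ | _) hk <;> simp_all [svTable])

/-- The Virasoro conformal algebra `ℂ[∂]L` with `[L_λ L] = (∂ + 2λ) L`. -/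
def Vir : LieConformalAlgebra (Unit → ℂ[X]) :=
  freeLie (fun _ _ _ => C X + 2 * X)
    (by intro _ _ _ t; simp; ring)
    (by intro _ _ _ _ t u; simp; ring)

end LieConformal

end

/-! The relative complex is isomorphic to the basic complex of `Vir`, not merely quasi-isomorphic to
it, so basic and reduced cohomology agree at once. Only `⟨N⟩ ≤ B ≤ ⟨N, Y, M⟩` matters.

The zero mode of `N` acts on `ℂ[∂]L`, `ℂ[∂]N`, `ℂ[∂]Y`, `ℂ[∂]M` by the scalars 0, 0, 1, 2. Putting
`λ_0 = 0` in `(dγ)(N, a_1, …, a_n) = 0` shows that a relative cochain is invariant under this mode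
(`sum_update_bracket_eq_zero`). On homogeneous arguments `γ` is therefore annihilated by their total
weight, and as weights are nonnegative, an argument in `ℂ[∂]Y` or `ℂ[∂]M` forces `γ = 0`; an
argument in `ℂ[∂]N` does so by relativity (`relCochains_single_eq_zero`). Hence `γ` is determined by
its values on `ℂ[∂]L`.

Conversely, `⟨N, Y, M⟩` is an ideal with quotient `Vir`, so cochains of `Vir` pull back along
`svProj` to relative cochains (`pullback_svProj_mem`). This pullback and the restriction along
`virIncl` are mutually inverse and commute with `d` and `∂`. Neither `d ∘ d = 0` nor stability of
the cochain spaces under `d` is needed. -/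

open Polynomial

noncomputable section

namespace LieConformal

/-! ### Functoriality of cochains under morphisms. -/

section Pullback

variable {A A' : Type*} [AddCommGroup A] [Module ℂ A] [AddCommGroup A'] [Module ℂ A']

/-- Pullback of functions `(a_1, …, a_n) ↦ γ(a_1, …, a_n)` along a linear map. -/
def pullback (f : A →ₗ[ℂ] A') (n : ℕ) : PreCochain A' n →ₗ[ℂ] PreCochain A n where
  toFun γ := fun a => γ (f ∘ a)
  map_add' _ _ := rfl
  map_smul' _ _ := rfl

theorem pullback_apply (f : A →ₗ[ℂ] A') (n : ℕ) (γ : PreCochain A' n) (a : Fin n → A) :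
    pullback f n γ a = γ (f ∘ a) := rfl

theorem pullback_del (f : A →ₗ[ℂ] A') (n : ℕ) (γ : PreCochain A' n) :
    pullback f n (del A' n γ) = del A n (pullback f n γ) := rfl

/-- Morphisms of Lie conformal algebras. -/
structure IsMorphism (𝒜 : LieConformalAlgebra A) (𝒜' : LieConformalAlgebra A')
    (f : A →ₗ[ℂ] A') : Prop where
  map_der : ∀ a, f (𝒜.der a) = 𝒜'.der (f a)
  map_bracket : ∀ a b n, f (𝒜.bracket a b n) = 𝒜'.bracket (f a) (f b) n

variable {𝒜 : LieConformalAlgebra A} {𝒜' : LieConformalAlgebra A'} {f : A →ₗ[ℂ] A'}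

theorem pullback_mem_cochains (hf : IsMorphism 𝒜 𝒜' f) (n : ℕ) (γ : PreCochain A' n)
    (hγ : γ ∈ cochains 𝒜' n) : pullback f n γ ∈ cochains 𝒜 n := by
  obtain ⟨⟨g, rfl⟩, h1, h2⟩ := hγ
  refine ⟨⟨g.compLinearMap fun _ => f, rfl⟩, fun a i => ?_, fun a σ => ?_⟩
  · rw [pullback_apply, Function.comp_update, hf.map_der]
    exact h1 (f ∘ a) i
  · exact h2 (f ∘ a) σ

theorem apply_eq_zero_of_coord_eq_zero {n : ℕ} {γ : PreCochain A n} (hγ : γ ∈ cochains 𝒜 n)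
    (a : Fin n → A) (i : Fin n) (h : a i = 0) : γ a = 0 := by
  obtain ⟨⟨g, rfl⟩, -, -⟩ := hγ
  exact g.map_coord_zero i h

theorem comp_consOmit {m : ℕ} (c : A) (a : Fin (m + 2) → A) (i : Fin (m + 1))
    (j : Fin (m + 2)) : f ∘ consOmit c a i j = consOmit (f c) (f ∘ a) i j := by
  ext1 k
  refine Fin.cases ?_ (fun k => ?_) k <;> simp [consOmit]

/-- `f` may kill coefficients of the bracket, so the two sums can have different supports; the extra
terms contain `γ` with a zero argument. This is why `γ` has to be multilinear and not an arbitrary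
function. -/
theorem dTerm_pullback (hf : IsMorphism 𝒜 𝒜' f) {m : ℕ} {γ : PreCochain A' (m + 1)}
    (hγ : γ ∈ cochains 𝒜' (m + 1)) (a : Fin (m + 2) → A) (i : Fin (m + 1)) (j : Fin (m + 2)) :
    dTerm 𝒜 (pullback f _ γ) a i j = dTerm 𝒜' γ (f ∘ a) i j := by
  have hb : 𝒜'.bracket (f (a i.castSucc)) (f (a j)) =
      (𝒜.bracket (a i.castSucc) (a j)).mapRange f (map_zero f) := by
    ext1 n
    rw [Finsupp.mapRange_apply, hf.map_bracket]
  simp only [dTerm, Function.comp_apply, hb]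
  rw [Finsupp.sum_mapRange_index]
  · simp only [pullback_apply, comp_consOmit]
  · intro k
    rw [apply_eq_zero_of_coord_eq_zero hγ _ 0 (by simp [consOmit]), map_zero, mul_zero]

theorem d_pullback (hf : IsMorphism 𝒜 𝒜' f) (n : ℕ) {γ : PreCochain A' n}
    (hγ : γ ∈ cochains 𝒜' n) : d 𝒜 n (pullback f n γ) = pullback f (n + 1) (d 𝒜' n γ) := by
  cases n with
  | zero => simp [d]
  | succ m =>
    ext1 a
    simp only [d, pullback_apply, LinearMap.coe_mk, AddHom.coe_mk, dTerm_pullback hf hγ]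

/-! ### Relative cochains and invariance under zero modes. -/

theorem succAbove_succAbove_zero {m : ℕ} {i : Fin (m + 2)} {j : Fin (m + 3)}
    (hi : i ≠ 0) (hij : i.castSucc < j) : j.succAbove (i.succAbove 0) = 0 := by
  rw [Fin.succAbove_ne_zero_zero hi, Fin.succAbove_ne_zero_zero]
  rintro rfl
  simp at hij

/-- If the bracket does not involve `a 0`, then `a 0` survives as an argument, directly behind the
bracket in slot 1. The predicate `p` will be both "equal to zero" and "lies in the subalgebra". -/
theorem dTerm_eq_zero_of_forall {m : ℕ} {γ : PreCochain A (m + 1)} {p : A → Prop}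
    (hγ : ∀ (a : Fin (m + 1) → A) k, p (a k) → γ a = 0) {a : Fin (m + 2) → A} (ha : p (a 0))
    {i : Fin (m + 1)} {j : Fin (m + 2)} (hi : i ≠ 0) (hij : i.castSucc < j) :
    dTerm 𝒜 γ a i j = 0 := by
  cases m with
  | zero => exact absurd (Fin.fin_one_eq_zero i) hi
  | succ m =>
    refine Finset.sum_eq_zero fun k _ => ?_
    simp only
    rw [hγ _ (Fin.succ 0), map_zero, mul_zero]
    simpa [consOmit, succAbove_succAbove_zero hi hij] using ha

theorem d_apply_eq_zero_of_eq_zero {n : ℕ} {γ : PreCochain A n} (hγ : γ ∈ cochains 𝒜 n)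
    (a : Fin (n + 1) → A) (h : a 0 = 0) : d 𝒜 n γ a = 0 := by
  cases n with
  | zero => simp [d]
  | succ m =>
    simp only [d, LinearMap.coe_mk, AddHom.coe_mk]
    refine Finset.sum_eq_zero fun j _ => Finset.sum_eq_zero fun i _ => ?_
    split_ifs with hij
    · rcases eq_or_ne i 0 with rfl | hi
      · simp [dTerm, h]
      · rw [dTerm_eq_zero_of_forall (p := (· = 0))
          (fun b k hb => apply_eq_zero_of_coord_eq_zero hγ b k hb) h hi hij, smul_zero]
    · rfl

/-- Skew-symmetry under the transposition of slots 0 and `i` reduces to the defining condition on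
the first argument. -/
theorem relCochains_apply_eq_zero {ℬ : ConformalSubalgebra 𝒜} {n : ℕ} {γ : PreCochain A n}
    (hγ : γ ∈ relCochains 𝒜 ℬ n) (a : Fin n → A) (i : Fin n) (h : a i ∈ ℬ.carrier) :
    γ a = 0 := by
  obtain ⟨⟨-, -, h2⟩, h3, -⟩ := hγ
  have hn : 0 < n := i.pos
  have h4 := h2 a (Equiv.swap ⟨0, hn⟩ i)
  rw [h3 _ hn (by simpa using h), map_zero] at h4
  rcases Int.units_eq_one_or (Equiv.Perm.sign (Equiv.swap ⟨0, hn⟩ i)) with hs | hs <;>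
    simpa [hs] using h4.symm

/-- The specialization `λ_0 = 0` of the term of `dγ` that contains `[b_{λ_0} a_j]`. -/
theorem aeval_dTerm_cons {m : ℕ} {γ : PreCochain A (m + 1)} (hγ : γ ∈ cochains 𝒜 (m + 1))
    (b : A) (a : Fin (m + 1) → A) (j : Fin (m + 1)) :
    MvPolynomial.aeval (Fin.cons 0 MvPolynomial.X : Fin (m + 2) → MvPolynomial (Fin (m + 1)) ℂ)
      (dTerm 𝒜 γ (Fin.cons b a) 0 j.succ) =
    (-1 : ℂ) ^ (j : ℕ) • γ (Function.update a j (𝒜.bracket b (a j) 0)) := by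
  set c := 𝒜.bracket b (a j) with hc
  -- The bracket stands in front in `dTerm`, but in slot `j` in the result. The cycle moving it
  -- there has sign `(-1) ^ j`, the source of the sign in the statement.
  have hcomp : (Function.update a j (c 0)) ∘ j.cycleRange.symm =
      Fin.cons (c 0) fun k => a (j.succAbove k) := by
    ext1 k
    refine Fin.cases ?_ (fun k => ?_) k
    · simp
    · simp [Fin.succAbove_ne]
  have hskew := hγ.2.2 (Function.update a j (c 0)) j.cycleRange.symm
  rw [hcomp, Equiv.Perm.sign_symm, Fin.sign_cycleRange] at hskew
  have hcons : ∀ x : A, consOmit x (Fin.cons b a : Fin (m + 2) → A) 0 j.succ =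
      Fin.cons x fun k => a (j.succAbove k) := by
    intro x
    ext1 k
    refine Fin.cases ?_ (fun k => ?_) k <;> simp [consOmit]
  have hz : γ (Fin.cons 0 fun k => a (j.succAbove k)) = 0 :=
    apply_eq_zero_of_coord_eq_zero hγ _ 0 (by simp)
  -- At `λ_0 = 0` the variable `λ_0 + λ_j` becomes `λ_j`, so the substitution is just the
  -- permutation of variables that matches `hcomp`.
  have hpoly : ∀ p : MvPolynomial (Fin (m + 1)) ℂ,
      MvPolynomial.aeval (Fin.cons 0 MvPolynomial.X :
          Fin (m + 2) → MvPolynomial (Fin (m + 1)) ℂ)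
        (MvPolynomial.aeval (consOmit (MvPolynomial.X (Fin.castSucc (0 : Fin (m + 1))) +
          MvPolynomial.X j.succ : MvPolynomial (Fin (m + 2)) ℂ) MvPolynomial.X 0 j.succ) p) =
      MvPolynomial.rename j.cycleRange.symm p := by
    intro p
    rw [← AlgHom.comp_apply]
    congr 1
    ext1 k
    refine Fin.cases ?_ (fun k => ?_) k
    · simp [consOmit]
    · simp [consOmit]
  have hsum : dTerm 𝒜 γ (Fin.cons b a) 0 j.succ = c.sum fun k x =>
      MvPolynomial.X 0 ^ k * MvPolynomial.aeval
        (consOmit (MvPolynomial.X (Fin.castSucc (0 : Fin (m + 1))) + MvPolynomial.X j.succ)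
          MvPolynomial.X 0 j.succ) (γ (Fin.cons x fun k => a (j.succAbove k))) := by
    simp only [dTerm, hcons]
    simp [hc]
  rw [hsum, map_finsuppSum]
  simp only [map_mul, map_pow, MvPolynomial.aeval_X, Fin.cons_zero, hpoly]
  -- The factor `λ_0 ^ k` vanishes for `k ≠ 0`, leaving only the zero mode.
  rw [Finsupp.sum, Finset.sum_eq_single 0]
  · rw [pow_zero, one_mul, hskew]
    rcases Nat.even_or_odd (j : ℕ) with h' | h' <;> simp [h'.neg_one_pow]
  · intro k _ hk
    rw [zero_pow hk, zero_mul]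
  · intro h
    rw [Finsupp.notMem_support_iff.1 h, hz, map_zero, mul_zero]

/-- Relative cochains are invariant under the `0`-th mode of every element of the subalgebra. -/
theorem sum_update_bracket_eq_zero {ℬ : ConformalSubalgebra 𝒜} {n : ℕ} {γ : PreCochain A n}
    (hγ : γ ∈ relCochains 𝒜 ℬ n) {b : A} (hb : b ∈ ℬ.carrier) (a : Fin n → A) :
    ∑ j, γ (Function.update a j (𝒜.bracket b (a j) 0)) = 0 := by
  cases n with
  | zero => simp
  | succ m =>
    have h := hγ.2.2 (Fin.cons b a) (by simpa using hb)
    -- Specialize `(dγ)(b, a_1, …) = 0` at `λ_0 = 0`.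
    have h' := congrArg (MvPolynomial.aeval
      (Fin.cons 0 MvPolynomial.X : Fin (m + 2) → MvPolynomial (Fin (m + 1)) ℂ)) h
    rw [map_zero] at h'
    simp only [d, LinearMap.coe_mk, AddHom.coe_mk] at h'
    rw [Fin.sum_univ_succ] at h'
    simp only [Fin.not_lt_zero, if_false, Finset.sum_const_zero, zero_add] at h'
    rw [map_sum] at h'
    rw [← neg_eq_zero, ← h', ← Finset.sum_neg_distrib]
    refine Finset.sum_congr rfl fun j _ => ?_
    rw [Finset.sum_eq_single 0]
    · rw [if_pos (by simp [Fin.lt_def]), map_smul, aeval_dTerm_cons hγ.1, smul_smul, ← pow_add]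
      -- The differential contributes `(-1) ^ (j + 1)` and the cycle `(-1) ^ j`, so all terms carry
      -- the same sign `-1`.
      rw [Odd.neg_one_pow (by simp [parity_simps]), neg_one_smul]
    · intro i _ hi
      split_ifs with hij
      -- Brackets not involving `b` leave `b` as an argument of `γ`, which vanishes there by
      -- relativity.
      · rw [dTerm_eq_zero_of_forall (p := (· ∈ ℬ.carrier))
          (fun b k hb => relCochains_apply_eq_zero hγ b k hb) (by simpa using hb) hi hij, smul_zero]
      · rfl
    · simp

end Pullback

/-! ### Isomorphisms of complexes induce isomorphisms of cohomology. -/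

section Equivalence

variable {A A' : Type*} [AddCommGroup A] [Module ℂ A] [AddCommGroup A'] [Module ℂ A']
  {𝒜 : LieConformalAlgebra A} {𝒜' : LieConformalAlgebra A'}

/-- Maps `K → K'` that commute with the differentials and with `∂`. -/
structure IsCochainMap (K : CochainSpaces 𝒜) (K' : CochainSpaces 𝒜')
    (F : ∀ n, PreCochain A n →ₗ[ℂ] PreCochain A' n) : Prop where
  map_mem : ∀ n, ∀ γ ∈ K.space n, F n γ ∈ K'.space n
  -- Imposed only on `K.space n`, since `d_pullback` is available only for cochains.
  map_d : ∀ n, ∀ γ ∈ K.space n, F (n + 1) (d 𝒜 n γ) = d 𝒜' n (F n γ)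
  map_del : ∀ n γ, F n (del A n γ) = del A' n (F n γ)

variable {K : CochainSpaces 𝒜} {K' : CochainSpaces 𝒜'}
  {F : ∀ n, PreCochain A n →ₗ[ℂ] PreCochain A' n} {G : ∀ n, PreCochain A' n →ₗ[ℂ] PreCochain A n}

namespace IsCochainMap

theorem map_mem_cocycles (hF : IsCochainMap K K' F) {q : ℕ} {γ : PreCochain A q}
    (h : γ ∈ cocycles K q) : F q γ ∈ cocycles K' q := by
  refine ⟨hF.map_mem q γ h.1, ?_⟩
  have h2 : d 𝒜 q γ = 0 := h.2
  change d 𝒜' q (F q γ) = 0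
  rw [← hF.map_d q γ h.1, h2, map_zero]

theorem map_mem_coboundaries (hF : IsCochainMap K K' F) {q : ℕ} {γ : PreCochain A q}
    (h : γ ∈ coboundaries K q) : F q γ ∈ coboundaries K' q := by
  cases q with
  | zero =>
    have h2 : γ = 0 := h
    rw [h2, map_zero]
    exact zero_mem _
  | succ q =>
    obtain ⟨φ, hφ, rfl⟩ := h
    exact ⟨F q φ, hF.map_mem q φ hφ, (hF.map_d q φ hφ).symm⟩

theorem map_mem_delSpace (hF : IsCochainMap K K' F) {q : ℕ} {γ : PreCochain A q}
    (h : γ ∈ delSpace K q) : F q γ ∈ delSpace K' q := by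
  obtain ⟨φ, hφ, rfl⟩ := h
  exact ⟨F q φ, hF.map_mem q φ hφ, (hF.map_del q φ).symm⟩

theorem map_mem_reducedCocycles (hF : IsCochainMap K K' F) {q : ℕ} {γ : PreCochain A q}
    (h : γ ∈ reducedCocycles K q) : F q γ ∈ reducedCocycles K' q := by
  refine ⟨hF.map_mem q γ h.1, ?_⟩
  change d 𝒜' q (F q γ) ∈ delSpace K' (q + 1)
  rw [← hF.map_d q γ h.1]
  exact hF.map_mem_delSpace h.2

theorem map_mem_reducedCoboundaries (hF : IsCochainMap K K' F) {q : ℕ} {γ : PreCochain A q}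
    (h : γ ∈ reducedCoboundaries K q) : F q γ ∈ reducedCoboundaries K' q := by
  obtain ⟨x, hx, y, hy, rfl⟩ := Submodule.mem_sup.1 h
  rw [map_add]
  exact Submodule.add_mem_sup (hF.map_mem_coboundaries hx) (hF.map_mem_delSpace hy)

end IsCochainMap

/-- Linear maps that are inverse to each other on subspaces `Z`, `Z'` and respect subspaces
`B`, `B'` induce an isomorphism of the subquotients. -/
def subquotientEquiv {V V' : Type*} [AddCommGroup V] [Module ℂ V] [AddCommGroup V'] [Module ℂ V']
    (f : V →ₗ[ℂ] V') (g : V' →ₗ[ℂ] V) {Z B : Submodule ℂ V} {Z' B' : Submodule ℂ V'}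
    (hf : ∀ v ∈ Z, f v ∈ Z') (hg : ∀ v ∈ Z', g v ∈ Z)
    (hfB : ∀ v ∈ B, f v ∈ B') (hgB : ∀ v ∈ B', g v ∈ B)
    (hgf : ∀ v ∈ Z, g (f v) = v) (hfg : ∀ v ∈ Z', f (g v) = v) :
    (Z ⧸ B.comap Z.subtype) ≃ₗ[ℂ] (Z' ⧸ B'.comap Z'.subtype) :=
  LinearEquiv.ofLinearMap
    (Submodule.mapQ _ _ (f.restrict hf) fun v hv => hfB v.1 hv)
    (Submodule.mapQ _ _ (g.restrict hg) fun v hv => hgB v.1 hv)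
    (Submodule.linearMap_qext _ (LinearMap.ext fun v =>
      congrArg Submodule.Quotient.mk (Subtype.ext (hfg v.1 v.2))))
    (Submodule.linearMap_qext _ (LinearMap.ext fun v =>
      congrArg Submodule.Quotient.mk (Subtype.ext (hgf v.1 v.2))))

/-- Mutually inverse cochain maps induce an isomorphism of cohomology that commutes with `∂`. -/
theorem exists_cohomology_equiv (hF : IsCochainMap K K' F) (hG : IsCochainMap K' K G)
    (hGF : ∀ n, ∀ γ ∈ K.space n, G n (F n γ) = γ)
    (hFG : ∀ n, ∀ γ ∈ K'.space n, F n (G n γ) = γ) (q : ℕ) :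
    ∃ e : Cohomology K q ≃ₗ[ℂ] Cohomology K' q,
      ∀ x, e (cohomologyDel K q x) = cohomologyDel K' q (e x) := by
  refine ⟨subquotientEquiv (F q) (G q) (fun _ => hF.map_mem_cocycles)
    (fun _ => hG.map_mem_cocycles) (fun _ => hF.map_mem_coboundaries)
    (fun _ => hG.map_mem_coboundaries) (fun γ h => hGF q γ h.1) (fun γ h => hFG q γ h.1), ?_⟩
  intro x
  obtain ⟨γ, rfl⟩ := Submodule.Quotient.mk_surjective _ x
  exact congrArg (Submodule.Quotient.mk (p := (coboundaries K' q).comap (cocycles K' q).subtype))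
    (Subtype.ext (hF.map_del q γ.1))

/-- Mutually inverse cochain maps induce an isomorphism of reduced cohomology. -/
theorem nonempty_reducedCohomology_equiv (hF : IsCochainMap K K' F) (hG : IsCochainMap K' K G)
    (hGF : ∀ n, ∀ γ ∈ K.space n, G n (F n γ) = γ)
    (hFG : ∀ n, ∀ γ ∈ K'.space n, F n (G n γ) = γ) (q : ℕ) :
    Nonempty (ReducedCohomology K q ≃ₗ[ℂ] ReducedCohomology K' q) :=
  ⟨subquotientEquiv (F q) (G q) (fun _ => hF.map_mem_reducedCocycles)
    (fun _ => hG.map_mem_reducedCocycles) (fun _ => hF.map_mem_reducedCoboundaries)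
    (fun _ => hG.map_mem_reducedCoboundaries) (fun γ h => hGF q γ h.1) (fun γ h => hFG q γ h.1)⟩

end Equivalence

/-! ### `Vir` as a retract of `SV`. -/

/-- The projection of the extended Schrödinger–Virasoro conformal algebra onto `ℂ[∂]L`. -/
def svProj : (SVGen → ℂ[X]) →ₗ[ℂ] (Unit → ℂ[X]) where
  toFun a := fun _ => a .L
  map_add' _ _ := rfl
  map_smul' _ _ := rfl

/-- The inclusion of the Virasoro conformal algebra. -/
def virIncl : (Unit → ℂ[X]) →ₗ[ℂ] (SVGen → ℂ[X]) :=
  LinearMap.single ℂ (fun _ : SVGen => ℂ[X]) .L ∘ₗ LinearMap.proj ()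

theorem virIncl_apply (a : Unit → ℂ[X]) : virIncl a = Pi.single .L (a ()) := rfl

theorem svProj_virIncl (a : Unit → ℂ[X]) : svProj (virIncl a) = a := by
  ext1
  simp [svProj, virIncl_apply]

theorem SV_bracket_apply (a b : SVGen → ℂ[X]) (n : ℕ) (k : SVGen) :
    SV.bracket a b n k = (freePoly svTable a b k).coeff n := rfl

theorem Vir_bracket_apply (a b : Unit → ℂ[X]) (n : ℕ) (k : Unit) :
    Vir.bracket a b n k =
      (freePoly (fun _ _ _ : Unit => (C X + 2 * X : ℂ[X][X])) a b k).coeff n := rfl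

/-- Among brackets of generators only `[L_λ L]` has a component along `L`; equivalently, `⟨N, Y, M⟩`
is an ideal. -/
theorem isMorphism_svProj : IsMorphism SV Vir svProj where
  map_der _ := rfl
  map_bracket a b n := by
    ext1
    rw [Vir_bracket_apply]
    change SV.bracket a b n .L = _
    rw [SV_bracket_apply]
    simp [freePoly, sum_svGen, svTable, svProj]

theorem isMorphism_virIncl : IsMorphism Vir SV virIncl where
  map_der a := by
    ext1 k
    change (Pi.single SVGen.L (X * a ()) : SVGen → ℂ[X]) k =
      X * (Pi.single SVGen.L (a ()) : SVGen → ℂ[X]) k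
    cases k <;> simp
  map_bracket a b n := by
    ext1 k
    rw [SV_bracket_apply, virIncl_apply, virIncl_apply, virIncl_apply, Vir_bracket_apply]
    cases k <;> simp [freePoly, sum_svGen, svTable]

/-! ### The weight argument for the zero mode of `N`. -/

/-- The eigenvalues of the `0`-th mode of `N` on the generators. -/
def svWeight : SVGen → ℕ
  | .L => 0
  | .N => 0
  | .Y => 1
  | .M => 2

/-- `[N_λ p(∂)g] = p(∂ + λ)[N_λ g]`, so at `λ = 0` the polynomial `p` is unchanged, and `[N_λ L] =
λN` vanishes. -/
theorem bracket_N_single (g : SVGen) (p : ℂ[X]) :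
    SV.bracket (Pi.single .N 1) (Pi.single g p) 0 = (svWeight g : ℂ) • Pi.single g p := by
  ext1 k
  rw [SV_bracket_apply, coeff_zero_eq_eval_zero, eval_freePoly]
  cases g <;> cases k <;> simp [sum_svGen, svTable, svWeight, Polynomial.smul_eq_C_mul]
  rw [mul_comm]
  rfl

section Relative

variable {B : ConformalSubalgebra SV} {n : ℕ} {γ : PreCochain (SVGen → ℂ[X]) n}

theorem relCochains_single_eq_zero (hB : genSpan {.N} ≤ B.carrier) (hγ : γ ∈ relCochains SV B n)
    (g : Fin n → SVGen) (p : Fin n → ℂ[X]) (i : Fin n) (hi : g i ≠ .L) :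
    γ (fun j => Pi.single (g j) (p j)) = 0 := by
  by_cases hN : g i = .N
  · refine relCochains_apply_eq_zero hγ _ i (hB ?_)
    rw [mem_genSpan]
    intro k hk
    rw [hN]
    exact Pi.single_eq_of_ne hk _
  · have hb : (Pi.single .N 1 : SVGen → ℂ[X]) ∈ B.carrier := by
      refine hB ((mem_genSpan _ _).2 fun k hk => ?_)
      exact Pi.single_eq_of_ne hk _
    have h := sum_update_bracket_eq_zero hγ hb (fun j => Pi.single (g j) (p j))
    obtain ⟨f, rfl⟩ := hγ.1.1
    simp only [bracket_N_single, MultilinearMap.map_update_smul, Function.update_eq_self,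
      ← Finset.sum_smul, ← Nat.cast_sum] at h
    -- `h` now says that the total weight of the arguments times the value of `γ` is zero.
    refine (smul_eq_zero.1 h).resolve_left ?_
    have h1 : svWeight (g i) ≠ 0 := by
      cases hg : g i <;> simp_all [svWeight]
    intro h0
    -- No cancellation is possible: the weights are natural numbers, so a zero sum makes each of
    -- them zero.
    exact h1 (Finset.sum_eq_zero_iff.1 (Nat.cast_eq_zero.1 h0) i (Finset.mem_univ i))

theorem pullback_svProj_virIncl (hB : genSpan {.N} ≤ B.carrier) (hγ : γ ∈ relCochains SV B n) :
    pullback svProj n (pullback virIncl n γ) = γ := by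
  ext1 a
  have hsingle := relCochains_single_eq_zero hB hγ
  obtain ⟨f, rfl⟩ := hγ.1.1
  have ha : a = fun j => ∑ g, Pi.single g (a j g) := by
    ext1 j
    exact (Finset.univ_sum_single (a j)).symm
  conv_rhs => rw [ha]
  -- Expand every argument along the generators; only the term with `L` in all slots survives.
  rw [MultilinearMap.map_sum, Finset.sum_eq_single fun _ => SVGen.L]
  · rfl
  · intro g _ hg
    obtain ⟨i, hi⟩ := Function.ne_iff.1 hg
    exact hsingle g (fun j => a j (g j)) i hi
  · simp

/-- `svProj` kills `B`, and `d` commutes with the pullback, so both relative conditions become the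
vanishing of a function at a zero first argument. -/
theorem pullback_svProj_mem (hB : B.carrier ≤ genSpan {.N, .Y, .M}) {γ : PreCochain (Unit → ℂ[X]) n}
    (hγ : γ ∈ cochains Vir n) : pullback svProj n γ ∈ relCochains SV B n := by
  have hker : ∀ a ∈ B.carrier, svProj a = 0 := by
    intro a ha
    ext1
    exact (mem_genSpan _ _).1 (hB ha) .L (by simp)
  refine ⟨pullback_mem_cochains isMorphism_svProj n γ hγ, fun a hn ha => ?_, fun b hb => ?_⟩
  · exact apply_eq_zero_of_coord_eq_zero hγ _ ⟨0, hn⟩ (hker _ ha)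
  · rw [d_pullback isMorphism_svProj n hγ]
    exact d_apply_eq_zero_of_eq_zero hγ _ (hker _ hb)

end Relative

theorem genSpan_mono {S T : Set SVGen} (h : S ⊆ T) : genSpan S ≤ genSpan T := by
  intro a ha
  rw [mem_genSpan] at ha ⊢
  exact fun i hi => ha i fun hS => hi (h hS)

end LieConformal

end

/-! ### The isomorphisms of basic and reduced cohomology. -/

open LieConformal in
theorem mainTheorem10 (B : ConformalSubalgebra SV) (hB : B = subN ∨ B = subNM ∨ B = subNYM)
    (q : ℕ) :
    (∃ e : Cohomology (relComplex SV B) q ≃ₗ[ℂ] Cohomology (basicComplex Vir) q,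
      ∀ x, e (cohomologyDel (relComplex SV B) q x) = cohomologyDel (basicComplex Vir) q (e x)) ∧
    Nonempty (ReducedCohomology (relComplex SV B) q ≃ₗ[ℂ]
      ReducedCohomology (basicComplex Vir) q) := by
  have h : genSpan {.N} ≤ B.carrier ∧ B.carrier ≤ genSpan {.N, .Y, .M} := by
    rcases hB with rfl | rfl | rfl
    · exact ⟨le_rfl, genSpan_mono (by simp)⟩
    · exact ⟨genSpan_mono (by simp), genSpan_mono (by simp [Set.insert_subset_iff])⟩
    · exact ⟨genSpan_mono (by simp), le_rfl⟩
  have hF : IsCochainMap (relComplex SV B) (basicComplex Vir) (pullback virIncl) :=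
    ⟨fun n γ hγ => pullback_mem_cochains isMorphism_virIncl n γ hγ.1,
      fun n γ hγ => (d_pullback isMorphism_virIncl n hγ.1).symm, pullback_del virIncl⟩
  have hG : IsCochainMap (basicComplex Vir) (relComplex SV B) (pullback svProj) :=
    ⟨fun n γ hγ => pullback_svProj_mem h.2 hγ,
      fun n γ hγ => (d_pullback isMorphism_svProj n hγ).symm, pullback_del svProj⟩
  have hGF : ∀ n, ∀ γ ∈ (relComplex SV B).space n,
      pullback svProj n (pullback virIncl n γ) = γ :=
    fun n γ hγ => pullback_svProj_virIncl h.1 hγ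
  have hFG : ∀ n, ∀ γ ∈ (basicComplex Vir).space n,
      pullback virIncl n (pullback svProj n γ) = γ := by
    intro n γ _
    ext1 a
    exact congrArg γ (funext fun j => svProj_virIncl (a j))
  exact ⟨exists_cohomology_equiv hF hG hGF hFG q,
    nonempty_reducedCohomology_equiv hF hG hGF hFG q⟩
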